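/- Let $k\in\mathbb N$, let $W_k=(W_k(t))_{t\ge 0}$ be a $k$-dimensional vector of independent standard Brownian motions on a probability space $(\Omega,\mathcal F,P)$, let $b\in(0,1)$ and put $D_k(r;b)=W_k(r+b)-W_k(r)$ for $r\in(0,1-b)$. Let $\Phi_k$ be a random $k\times k$ real matrix on the same probability space that is almost surely invertible, and let $c^*>0$. With the convention $\log x=-\infty$ for $x\le 0$, and with $\max$ and $\min$ understood as supremum and infimum in $[-\infty,+\infty]$, define the fixed-$b$ pivotal limit of the penalized blockwise empirical likelihood (PBEL) ratio statistic by $$U_{pbel,k}(b)=\min_{\mu\in\mathbb R^k}\left\{\frac2b\max_{\lambda\in\mathbb R^k}\int_0^{1-b}\log\left\{1+\lambda'\left(D_k(r;b)/b-\mu\right)\right\}dr+\frac{c^*}{b}\,\mu'\Phi_k^{-1}\mu\right\}.$$ Then $U_{pbel,k}(b)$ is finite with probability one; in particular $P(U_{pbel,k}(b)<\infty)=1$. The same holds for the limit in its original form: for every invertible $\Lambda\in\mathbb R^{k\times k}$, the quantity $$\min_{\mu\in\mathcal H(b)}\left\{\frac2b\max_{\lambda\in\mathbb R^k}\int_0^{1-b}\log\left\{1+\lambda'\left(\Lambda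 D_k(r;b)/b-\mu\right)\right\}dr+\frac{c^*}{b}\,\mu'(\Lambda\Phi_k\Lambda')^{-1}\mu\right\},$$ where $\mathcal H(b)$ is the convex hull of $\{\Lambda D_k(r;b)/b: r\in(0,1-b)\}$, is finite with probability one. -/

import Mathlib

open MeasureTheory ProbabilityTheory
open scoped NNReal ENNReal Matrix

noncomputable section

/-- `W` is a `k`-dimensional vector of independent standard Brownian motions under `P`. -/
structure IsStdBrownianVector {Ω : Type*} [MeasurableSpace Ω] {k : ℕ}
    (W : ℝ≥0 → Ω → Fin k → ℝ) (P : Measure Ω) : Prop where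
  brownian : ∀ i, IsBrownianReal (fun t ω => W t ω i) P
  indep : iIndepFun (fun i ω (t : ℝ≥0) => W t ω i) P

/-- The logarithm with the convention `log x = -∞` for `x ≤ 0`. -/
def extLog (x : ℝ) : EReal := if 0 < x then ((Real.log x : ℝ) : EReal) else ⊥

/-- The integral of an extended-real function, as (integral of the positive part) minus
(integral of the negative part). In the uses below the positive part is bounded and the
measure is finite, so that the value is always meaningful and possibly `-∞`. -/
def extIntegral {α : Type*} [MeasurableSpace α] (ν : Measure α) (f : α → EReal) : EReal :=
  ((∫⁻ x, (f x).toENNReal ∂ν : ℝ≥0∞) : EReal) - ((∫⁻ x, (-f x).toENNReal ∂ν : ℝ≥0∞) : EReal)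

/-- The increment `D_k(r; b) = w(r + b) - w(r)` of a path `w`, for `r ≥ 0` and `b ≥ 0`. -/
def pathIncr {k : ℕ} (w : ℝ≥0 → Fin k → ℝ) (b r : ℝ) : Fin k → ℝ :=
  w (r + b).toNNReal - w r.toNNReal

/-- `max_l ∫_0^{1-b} log (1 + l' (g(r) - m)) dr`, as a supremum in `[-∞, ∞]`. -/
def maxLogIntegral {k : ℕ} (b : ℝ) (g : ℝ → Fin k → ℝ) (m : Fin k → ℝ) : EReal :=
  ⨆ l : Fin k → ℝ,
    extIntegral (volume.restrict (Set.Ioo 0 (1 - b))) (fun r => extLog (1 + l ⬝ᵥ (g r - m)))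

/-- The penalized objective
`(2/b) max_l ∫_0^{1-b} log (1 + l' (g(r) - m)) dr + (c/b) m' V⁻¹ m`. -/
def pbelObjective {k : ℕ} (b c : ℝ) (g : ℝ → Fin k → ℝ) (V : Matrix (Fin k) (Fin k) ℝ)
    (m : Fin k → ℝ) : EReal :=
  ((2 / b : ℝ) : EReal) * maxLogIntegral b g m + ((c / b * (m ⬝ᵥ (V⁻¹ *ᵥ m)) : ℝ) : EReal)

/-- The pivotal limit `U_{pbel,k}(b)` on a path `w` with normalizer `Φ`:
`min_{m ∈ ℝ^k} {(2/b) max_l ∫_0^{1-b} log (1 + l' (D_k(r;b)/b - m)) dr + (c/b) m' Φ⁻¹ m}`. -/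
def pbelLimit {k : ℕ} (b c : ℝ) (w : ℝ≥0 → Fin k → ℝ) (Φ : Matrix (Fin k) (Fin k) ℝ) : EReal :=
  ⨅ m : Fin k → ℝ, pbelObjective b c (fun r => b⁻¹ • pathIncr w b r) Φ m

/-- The same limit in the form in which it arises from the statistic, before the change of
variables: the path is `Λ D_k(·;b)/b`, the normalizer is `Λ Φ Λ'`, and `m` ranges over the
convex hull of `{Λ D_k(r;b)/b : r ∈ (0, 1-b)}`. -/
def pbelLimitHull {k : ℕ} (b c : ℝ) (Λ : Matrix (Fin k) (Fin k) ℝ) (w : ℝ≥0 → Fin k → ℝ)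
    (Φ : Matrix (Fin k) (Fin k) ℝ) : EReal :=
  ⨅ m ∈ convexHull ℝ ((fun r : ℝ => Λ *ᵥ (b⁻¹ • pathIncr w b r)) '' Set.Ioo 0 (1 - b)),
    pbelObjective b c (fun r => Λ *ᵥ (b⁻¹ • pathIncr w b r)) (Λ * Φ * Λᵀ) m

end

section ExtIntegral

variable {α : Type*} [MeasurableSpace α] {ν : Measure α} {f : α → EReal}

/-! The argument is pathwise: Brownian motion enters through continuity, so the path is bounded by
some `R` on the interval. Above: at a relative interior point `m` of the hull, `m` can be pushed
away from every path point by a factor `ε`. A multiplier `l` keeping `1 + l ⬝ᵥ (g r - m)`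
nonnegative on the path then satisfies `l ⬝ᵥ (g r - m) ≤ ε⁻¹`; any other `l` gives integral `⊥`
(`maxLogIntegral_lt_top`). Below: `l = 0` makes the inner maximum nonnegative. It is `⊤` for `‖m‖ >
R` (`maxLogIntegral_eq_top`), and on the remaining ball the penalty is bounded by compactness. -/

lemma le_extIntegral {a : ℝ≥0∞} (h : ∀ᵐ x ∂ν, (a : EReal) ≤ f x) :
    ((a * ν Set.univ : ℝ≥0∞) : EReal) ≤ extIntegral ν f := by
  have hneg : ∫⁻ x, (-f x).toENNReal ∂ν = 0 := by
    rw [lintegral_congr_ae (g := fun _ => 0) ?_, lintegral_zero]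
    filter_upwards [h] with x hx
    apply EReal.toENNReal_of_nonpos
    rw [EReal.neg_le, neg_zero]
    exact (EReal.coe_ennreal_nonneg a).trans hx
  have hpos : a * ν Set.univ ≤ ∫⁻ x, (f x).toENNReal ∂ν := by
    rw [← lintegral_const]
    apply lintegral_mono_ae
    filter_upwards [h] with x hx
    simpa using EReal.toENNReal_le_toENNReal hx
  rw [extIntegral, hneg, EReal.coe_ennreal_zero, sub_zero]
  exact_mod_cast hpos

lemma extIntegral_le {a : ℝ≥0∞} (h : ∀ᵐ x ∂ν, f x ≤ a) :
    extIntegral ν f ≤ ((a * ν Set.univ : ℝ≥0∞) : EReal) := by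
  have hpos : ∫⁻ x, (f x).toENNReal ∂ν ≤ a * ν Set.univ := by
    rw [← lintegral_const]
    apply lintegral_mono_ae
    filter_upwards [h] with x hx
    simpa using EReal.toENNReal_le_toENNReal hx
  calc extIntegral ν f ≤ ((∫⁻ x, (f x).toENNReal ∂ν : ℝ≥0∞) : EReal) - 0 :=
        EReal.sub_le_sub le_rfl (EReal.coe_ennreal_nonneg _)
    _ ≤ _ := by rw [sub_zero]; exact_mod_cast hpos

lemma extIntegral_eq_bot {s : Set α} (hs : MeasurableSet s) (hν : ν s ≠ 0)
    (h : ∀ x ∈ s, f x = ⊥) : extIntegral ν f = ⊥ := by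
  have hneg : ∫⁻ x, (-f x).toENNReal ∂ν = ⊤ := by
    rw [← top_le_iff]
    calc (⊤ : ℝ≥0∞) = ∫⁻ _ in s, ⊤ ∂ν := by simp [ENNReal.top_mul hν]
      _ ≤ ∫⁻ x in s, (-f x).toENNReal ∂ν := by
        refine setLIntegral_mono' hs fun x hx => ?_
        simp [h x hx]
      _ ≤ _ := setLIntegral_le_lintegral _ _
  -- In `EReal`, `⊤ - ⊤ = ⊥`, so the positive part needs no bound.
  rw [extIntegral, hneg, EReal.coe_ennreal_top, EReal.sub_top]

end ExtIntegral

section Intrinsic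

/-- A point of the relative interior of a convex set `s` can be moved away from any point of a
bounded subset of `s` by a uniform factor without leaving `s`. -/
lemma exists_sub_smul_mem_of_mem_intrinsicInterior {E : Type*} [NormedAddCommGroup E]
    [NormedSpace ℝ E] {s : Set E} {m : E} (hm : m ∈ intrinsicInterior ℝ s) (R : ℝ) :
    ∃ ε : ℝ, 0 < ε ∧ ∀ x ∈ s, ‖x‖ ≤ R → m - ε • (x - m) ∈ s := by
  obtain ⟨y, hy, rfl⟩ := mem_intrinsicInterior.1 hm
  obtain ⟨δ, hδ, hball⟩ := Metric.mem_nhds_iff.1 (mem_interior_iff_mem_nhds.1 hy)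
  set C : ℝ := |R| + ‖(y : E)‖ + 1 with hC
  have hCpos : 0 < C := by positivity
  refine ⟨δ / (2 * C), by positivity, fun x hx hxR => ?_⟩
  have hspan : (y : E) - (δ / (2 * C)) • (x - y) ∈ affineSpan ℝ s := by
    have := AffineMap.lineMap_mem (-(δ / (2 * C))) y.2 (subset_affineSpan ℝ s hx)
    rw [AffineMap.lineMap_apply_module'] at this
    convert this using 1
    rw [neg_smul]
    abel
  refine hball (a := ⟨_, hspan⟩) ?_
  rw [Metric.mem_ball, Subtype.dist_eq, dist_eq_norm]
  have hxy : ‖x - (y : E)‖ ≤ C := by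
    have := norm_sub_le x (y : E)
    have := le_abs_self R
    linarith
  calc ‖(y : E) - (δ / (2 * C)) • (x - y) - y‖ = δ / (2 * C) * ‖x - (y : E)‖ := by
        rw [sub_sub_cancel_left, norm_neg, norm_smul, Real.norm_of_nonneg (by positivity)]
    _ ≤ δ / (2 * C) * C := by gcongr
    _ = δ / 2 := by field_simp
    _ < δ := by linarith

end Intrinsic

section Objective

variable {k : ℕ} {b c : ℝ} {g : ℝ → Fin k → ℝ} {m : Fin k → ℝ}

lemma extLog_le_coe {x a : ℝ} (ha : 1 ≤ a) (h : x ≤ a) :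
    extLog x ≤ (ENNReal.ofReal (Real.log a) : EReal) := by
  rw [EReal.coe_ennreal_ofReal, max_eq_left (Real.log_nonneg ha)]
  unfold extLog
  split_ifs with hx
  · exact_mod_cast Real.log_le_log hx h
  · exact bot_le

lemma coe_le_extLog {x a : ℝ} (ha : 1 ≤ a) (h : a ≤ x) :
    (ENNReal.ofReal (Real.log a) : EReal) ≤ extLog x := by
  rw [EReal.coe_ennreal_ofReal, max_eq_left (Real.log_nonneg ha), extLog, if_pos (by linarith)]
  exact_mod_cast Real.log_le_log (by linarith) h

lemma maxLogIntegral_nonneg : 0 ≤ maxLogIntegral b g m := by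
  refine le_trans ?_ (le_iSup _ 0)
  have := le_extIntegral (ν := volume.restrict (Set.Ioo 0 (1 - b))) (a := 0)
    (f := fun r => extLog (1 + (0 : Fin k → ℝ) ⬝ᵥ (g r - m))) (by simp [extLog])
  simpa using this

/-- If one coordinate of `m` exceeds that of the path in absolute value, uniformly, then the
inner maximum is infinite. -/
lemma maxLogIntegral_eq_top (hb1 : b < 1) {R : ℝ} (hg : ∀ r ∈ Set.Ioo 0 (1 - b), ‖g r‖ ≤ R)
    (hm : R < ‖m‖) : maxLogIntegral b g m = ⊤ := by
  have hR : 0 ≤ R := (norm_nonneg _).trans (hg ((1 - b) / 2) ⟨by linarith, by linarith⟩)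
  obtain ⟨i, hi⟩ : ∃ i, R < |m i| := by
    by_contra! h
    exact hm.not_ge ((pi_norm_le_iff_of_nonneg hR).2 h)
  have hδ : 0 < |m i| - R := by linarith
  have hL : 0 < 1 - b := by linarith
  rw [EReal.eq_top_iff_forall_lt]
  intro y
  -- `T` is the value of the logarithm whose integral over length `1 - b` is `|y| + 1 > y`; `t`
  -- solves `1 + t * (|m i| - R) = exp T`.
  set T : ℝ := (|y| + 1) / (1 - b) with hT
  have hT0 : 0 ≤ T := by positivity
  set t : ℝ := (Real.exp T - 1) / (|m i| - R) with ht
  have ht0 : 0 ≤ t := div_nonneg (by linarith [Real.one_le_exp hT0]) hδ.le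
  set l : Fin k → ℝ := Pi.single i (-(t * SignType.sign (m i))) with hl
  have hbound : ∀ᵐ r ∂volume.restrict (Set.Ioo 0 (1 - b)),
      (ENNReal.ofReal (Real.log (Real.exp T)) : EReal) ≤ extLog (1 + l ⬝ᵥ (g r - m)) := by
    refine (ae_restrict_iff' measurableSet_Ioo).2 (.of_forall fun r hr => ?_)
    refine coe_le_extLog (Real.one_le_exp hT0) ?_
    have hgi : |g r i| ≤ R := (norm_le_pi_norm (g r) i).trans (hg r hr)
    have hsg : (SignType.sign (m i) : ℝ) * g r i ≤ R := by
      have := abs_le.1 hgi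
      rcases lt_trichotomy (m i) 0 with h | h | h <;> simp [h] <;> linarith
    have hprod : l ⬝ᵥ (g r - m) = t * (|m i| - SignType.sign (m i) * g r i) := by
      rw [hl, single_dotProduct, Pi.sub_apply, ← sign_mul_self (m i)]
      ring
    have hte : t * (|m i| - R) = Real.exp T - 1 := by rw [ht]; field_simp
    rw [hprod]
    have : t * (|m i| - R) ≤ t * (|m i| - SignType.sign (m i) * g r i) := by gcongr
    linarith
  refine lt_of_lt_of_le ?_ ((le_extIntegral hbound).trans (le_iSup
    (fun l : Fin k → ℝ => extIntegral (volume.restrict (Set.Ioo 0 (1 - b)))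
      (fun r => extLog (1 + l ⬝ᵥ (g r - m)))) l))
  rw [Real.log_exp, Measure.restrict_apply_univ, Real.volume_Ioo, sub_zero,
    ← ENNReal.ofReal_mul hT0, hT, div_mul_cancel₀ _ hL.ne', EReal.coe_ennreal_ofReal]
  have : y < max (|y| + 1) 0 := lt_max_of_lt_left (by linarith [le_abs_self y])
  exact_mod_cast this

/-- At a point of the relative interior of the convex hull of a bounded continuous path, the inner
maximum is finite. -/
lemma maxLogIntegral_lt_top (hg : Continuous g) {R : ℝ}
    (hgR : ∀ r ∈ Set.Ioo 0 (1 - b), ‖g r‖ ≤ R)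
    (hm : m ∈ intrinsicInterior ℝ (convexHull ℝ (g '' Set.Ioo 0 (1 - b)))) :
    maxLogIntegral b g m < ⊤ := by
  obtain ⟨ε, hε, hmove⟩ := exists_sub_smul_mem_of_mem_intrinsicInterior hm R
  have hbound : maxLogIntegral b g m ≤ ((ENNReal.ofReal (Real.log (1 + ε⁻¹)) *
      volume.restrict (Set.Ioo 0 (1 - b)) Set.univ : ℝ≥0∞) : EReal) := by
    refine iSup_le fun l => ?_
    by_cases hpos : ∀ r ∈ Set.Ioo 0 (1 - b), 0 ≤ 1 + l ⬝ᵥ (g r - m)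
    · refine extIntegral_le ((ae_restrict_iff' measurableSet_Ioo).2 (.of_forall fun r hr => ?_))
      refine extLog_le_coe (by linarith [inv_pos.2 hε]) ?_
      -- This half-space contains the path, hence its hull; membership of `m - ε • (g r - m)` reads
      -- `ε * (l ⬝ᵥ (g r - m)) ≤ 1`.
      have hconv : Convex ℝ {x : Fin k → ℝ | l ⬝ᵥ m - 1 ≤ l ⬝ᵥ x} :=
        convex_halfSpace_ge ⟨dotProduct_add l, fun a x => dotProduct_smul a l x⟩ _
      have hsub : convexHull ℝ (g '' Set.Ioo 0 (1 - b)) ⊆ {x | l ⬝ᵥ m - 1 ≤ l ⬝ᵥ x} := by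
        refine convexHull_min ?_ hconv
        rintro _ ⟨s, hs, rfl⟩
        have := hpos s hs
        rw [dotProduct_sub] at this
        simp only [Set.mem_ofPred_eq]
        linarith
      have hmem := hsub (hmove (g r) (subset_convexHull ℝ _ ⟨r, hr, rfl⟩) (hgR r hr))
      simp only [Set.mem_ofPred_eq, dotProduct_sub l m, dotProduct_smul, smul_eq_mul] at hmem
      have : l ⬝ᵥ (g r - m) ≤ ε⁻¹ := by
        rw [← one_div, le_div_iff₀ hε]
        linarith
      linarith
    · push Not at hpos
      obtain ⟨r, hr, hneg⟩ := hpos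
      -- By continuity, one negative value spreads to an open set of positive measure.
      have hcont : Continuous fun r => 1 + l ⬝ᵥ (g r - m) := by fun_prop
      have hopen : IsOpen ({r | 1 + l ⬝ᵥ (g r - m) < 0} ∩ Set.Ioo 0 (1 - b)) :=
        (isOpen_lt hcont continuous_const).inter isOpen_Ioo
      rw [extIntegral_eq_bot (s := {r | 1 + l ⬝ᵥ (g r - m) < 0} ∩ Set.Ioo 0 (1 - b))
        hopen.measurableSet]
      · exact bot_le
      · rw [Measure.restrict_apply hopen.measurableSet, Set.inter_assoc, Set.inter_self]
        exact (hopen.measure_pos volume ⟨r, hneg, hr⟩).ne'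
      · rintro x ⟨hx, -⟩
        exact if_neg (not_lt.2 (le_of_lt hx))
  refine hbound.trans_lt (lt_top_iff_ne_top.2 ?_)
  rw [Ne, EReal.coe_ennreal_eq_top_iff, Measure.restrict_apply_univ]
  exact ENNReal.mul_ne_top ENNReal.ofReal_ne_top (by simp)

/-- A continuous function is bounded on a bounded interval. -/
lemma exists_norm_le_on_Ioo (hg : Continuous g) (u v : ℝ) :
    ∃ R : ℝ, ∀ r ∈ Set.Ioo u v, ‖g r‖ ≤ R := by
  obtain ⟨R, hR⟩ := (isCompact_Icc (a := u) (b := v)).exists_bound_of_continuousOn hg.continuousOn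
  exact ⟨R, fun r hr => hR r (Set.Ioo_subset_Icc_self hr)⟩

/-- The relative interior of a nonempty convex set in finite dimension is nonempty, even when the
hull has no interior. -/
lemma exists_pbelObjective_lt_top (hb1 : b < 1) (hg : Continuous g)
    (V : Matrix (Fin k) (Fin k) ℝ) :
    ∃ m ∈ convexHull ℝ (g '' Set.Ioo 0 (1 - b)), pbelObjective b c g V m < ⊤ := by
  obtain ⟨R, hR⟩ := exists_norm_le_on_Ioo hg 0 (1 - b)
  have hne : (convexHull ℝ (g '' Set.Ioo 0 (1 - b))).Nonempty :=
    ((Set.nonempty_Ioo.2 (by linarith)).image g).convexHull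
  obtain ⟨m, hm⟩ := hne.intrinsicInterior (convex_convexHull ℝ _)
  refine ⟨m, intrinsicInterior_subset hm, ?_⟩
  refine EReal.add_lt_top ?_ (EReal.coe_ne_top _)
  have hfin := maxLogIntegral_lt_top hg hR hm
  lift maxLogIntegral b g m to ℝ using ⟨hfin.ne,
    (EReal.bot_lt_zero.trans_le maxLogIntegral_nonneg).ne'⟩ with x
  rw [← EReal.coe_mul]
  exact EReal.coe_ne_top _

/-- The quadratic form may be indefinite, so the penalty alone need not be bounded below; outside
the ball the infinite inner maximum dominates it. -/
lemma exists_le_pbelObjective (hb0 : 0 < b) (hb1 : b < 1) (hg : Continuous g)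
    (V : Matrix (Fin k) (Fin k) ℝ) :
    ∃ C : ℝ, ∀ m, (C : EReal) ≤ pbelObjective b c g V m := by
  obtain ⟨R, hR⟩ := exists_norm_le_on_Ioo hg 0 (1 - b)
  have hcont : Continuous fun m : Fin k → ℝ => c / b * (m ⬝ᵥ (V⁻¹ *ᵥ m)) := by fun_prop
  obtain ⟨C, hC⟩ := (isCompact_closedBall (0 : Fin k → ℝ) R).exists_bound_of_continuousOn
    hcont.continuousOn
  have hpos : (0 : EReal) < ((2 / b : ℝ) : EReal) := by exact_mod_cast (by positivity : 0 < 2 / b)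
  refine ⟨-C, fun m => ?_⟩
  rcases le_or_gt ‖m‖ R with hm | hm
  · have hq := (abs_le.1 (hC m (by simpa using hm))).1
    calc ((-C : ℝ) : EReal) = 0 + ((-C : ℝ) : EReal) := (zero_add _).symm
      _ ≤ _ := add_le_add (EReal.mul_nonneg hpos.le maxLogIntegral_nonneg) (by exact_mod_cast hq)
  · rw [pbelObjective, maxLogIntegral_eq_top hb1 hR hm, EReal.mul_top_of_pos hpos,
      EReal.top_add_coe]
    exact le_top

end Objective

lemma continuous_pathIncr {k : ℕ} {w : ℝ≥0 → Fin k → ℝ} (hw : Continuous w) (b : ℝ) :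
    Continuous (pathIncr w b) := by
  unfold pathIncr
  fun_prop

lemma IsStdBrownianVector.ae_continuous {Ω : Type*} [MeasurableSpace Ω] {P : Measure Ω} {k : ℕ}
    {W : ℝ≥0 → Ω → Fin k → ℝ} (hW : IsStdBrownianVector W P) :
    ∀ᵐ ω ∂P, Continuous fun t => W t ω := by
  filter_upwards [ae_all_iff.2 fun i => (hW.brownian i).cont] with ω hω
  exact continuous_pi hω

theorem proposition4 {Ω : Type*} [MeasurableSpace Ω] (P : Measure Ω) [IsProbabilityMeasure P]
    {k : ℕ} (W : ℝ≥0 → Ω → Fin k → ℝ) (hW : IsStdBrownianVector W P)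
    (Φ : Ω → Matrix (Fin k) (Fin k) ℝ)
    (hΦ_meas : ∀ i j, AEMeasurable (fun ω => Φ ω i j) P)
    (hΦ_inv : ∀ᵐ ω ∂P, IsUnit (Φ ω).det)
    (Λ : Matrix (Fin k) (Fin k) ℝ) (hΛ : IsUnit Λ.det)
    (b : ℝ) (hb0 : 0 < b) (hb1 : b < 1) (c : ℝ) (hc : 0 < c) :
    (∀ᵐ ω ∂P, ⊥ < pbelLimit b c (fun t => W t ω) (Φ ω) ∧
      pbelLimit b c (fun t => W t ω) (Φ ω) < ⊤) ∧
    (∀ᵐ ω ∂P, ⊥ < pbelLimitHull b c Λ (fun t => W t ω) (Φ ω) ∧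
      pbelLimitHull b c Λ (fun t => W t ω) (Φ ω) < ⊤) := by

  constructor
  · filter_upwards [hW.ae_continuous] with ω hω
    have hD := continuous_pathIncr hω b
    have hg : Continuous fun r => b⁻¹ • pathIncr (fun t => W t ω) b r := by fun_prop
    obtain ⟨m, -, hm⟩ := exists_pbelObjective_lt_top (c := c) hb1 hg (Φ ω)
    obtain ⟨C, hC⟩ := exists_le_pbelObjective (c := c) hb0 hb1 hg (Φ ω)
    exact ⟨(EReal.bot_lt_coe C).trans_le (le_iInf hC), (iInf_le _ m).trans_lt hm⟩
  · filter_upwards [hW.ae_continuous] with ω hω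
    have hD := continuous_pathIncr hω b
    have hg : Continuous fun r => Λ *ᵥ (b⁻¹ • pathIncr (fun t => W t ω) b r) := by fun_prop
    obtain ⟨m, hmem, hm⟩ := exists_pbelObjective_lt_top (c := c) hb1 hg (Λ * Φ ω * Λᵀ)
    obtain ⟨C, hC⟩ := exists_le_pbelObjective (c := c) hb0 hb1 hg (Λ * Φ ω * Λᵀ)
    exact ⟨(EReal.bot_lt_coe C).trans_le (le_iInf₂ fun m _ => hC m),
      (iInf₂_le m hmem).trans_lt hm⟩
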